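/- Let $k\ge 1$ and let $Tr$ denote the absolute trace from $\mathbb{F}_{2^{2k}}$ to $\mathbb{F}_2$. A function $f:\mathbb{F}_{2^{2k}}\to\mathbb{F}_2$ is called bent if $$\sum_{x\in\mathbb{F}_{2^{2k}}}(-1)^{f(x)+Tr(\lambda x)}\in\{2^k,-2^k\}\quad\text{for every }\lambda\in\mathbb{F}_{2^{2k}}.$$ The number of bent components of a function $F:\mathbb{F}_{2^{2k}}\to\mathbb{F}_{2^{2k}}$ is the number of $\alpha\in\mathbb{F}_{2^{2k}}$ for which $x\mapsto Tr(\alpha F(x))$ is bent. Theorem. Let $d$ be an integer with $0<d<2^{2k}-1$. Then the monomial function $F(x)=x^d$ on $\mathbb{F}_{2^{2k}}$ has $2^{2k}-2^k$ bent components if and only if $d$ lies in the cyclotomic coset of $2^k+1$ modulo $2^{2k}-1$, that is, if and only if $d\equiv 2^i(2^k+1)\pmod{2^{2k}-1}$ for some integer $i\ge 0$. -/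

import Mathlib

/-- The Hadamard (Walsh) transform at `l` of a function `f` from a finite field `L` of
characteristic two to the prime field:
the integer `∑ x, (-1) ^ (f x + Tr (l * x))`, with `Tr` the absolute trace of `L`. -/
noncomputable def hadamard {L : Type*} [Field L] [Fintype L] [Algebra (ZMod 2) L]
    (f : L → ZMod 2) (l : L) : ℤ :=
  ∑ x : L, (-1 : ℤ) ^ (f x + Algebra.trace (ZMod 2) L (l * x)).val

/-- A function on the field with `2 ^ (2 * k)` elements is bent if its Hadamard transform takes
only the values `2 ^ k` and `-2 ^ k`. -/
def IsBent {L : Type*} [Field L] [Fintype L] [Algebra (ZMod 2) L]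
    (k : ℕ) (f : L → ZMod 2) : Prop :=
  ∀ l : L, hadamard f l = 2 ^ k ∨ hadamard f l = -2 ^ k

/-- The component function `x ↦ Tr (a * F x)` of a vectorial function `F`. -/
noncomputable def component {L : Type*} [Field L] [Algebra (ZMod 2) L]
    (F : L → L) (a : L) : L → ZMod 2 :=
  fun x => Algebra.trace (ZMod 2) L (a * F x)

/-- The number of bent components of a vectorial function `F` on the field with `2 ^ (2 * k)`
elements: the number of field elements `a` for which `x ↦ Tr (a * F x)` is bent. -/
noncomputable def numBentComponents {L : Type*} [Field L] [Fintype L] [Algebra (ZMod 2) L]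
    (k : ℕ) (F : L → L) : ℕ :=
  {a : L | IsBent k (component F a)}.ncard

/-- `d` lies in the cyclotomic coset of `e` modulo `2 ^ n - 1`:
up to a power of two as factor, `d` and `e` are congruent modulo `2 ^ n - 1`. -/
def CyclotomicEquiv (n d e : ℕ) : Prop :=
  ∃ i : ℕ, d ≡ 2 ^ i * e [MOD 2 ^ n - 1]

/-! ### Sign characters built from the absolute trace -/

open Finset WittVector
open scoped Pointwise

/-! Let `K ⊂ L` be the fields with `Q = 2 ^ k` and `Q ^ 2` elements, with norm `N` and relative
trace `T`.

If `d ≡ 2 ^ i * (Q + 1)`, then `x ^ d = N(x) ^ (2 ^ i)`. By Frobenius invariance of the trace, the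
component of `a` is a quadratic form proportional to `N` plus nothing else, nondegenerate and hence
bent exactly when `T(a) ≠ 0`. There are `Q ^ 2 - Q` such `a`.

Conversely, the `Q - 1` nonzero `a` with non-bent component form a union of cosets of the `d`-th
powers, while a bent component has transform at `0` congruent to `1` modulo `g = gcd(d, Q ^ 2 - 1)`.
Together these force `g = Q + 1` (`gcd_eq_of_numBentComponents`), so `x ^ d = N(x) ^ e` with `e`
invertible modulo `Q - 1`.

That `e` is a power of two comes from 2-adic Gauss sums (`exists_modEq_two_pow_of_traceChar_sum`).
Let `ω` be the Teichmüller character of `K` and `e * e' ≡ 1`. Write the Walsh values as `Q (1 - 2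
t)` with `t ∈ {0, 1}` and pair them with `ω⁻¹ ∘ N`. The result is a product of a Gauss sum of `ω ^
e'` and one of `ω⁻¹ ∘ N` over `L`, the latter being minus a square by Hasse–Davenport. After
cancelling powers of two, integrality of the `t` pairing makes half the Gauss sum of `ω ^ (-e')` a
unit modulo 2. By Stickelberger's congruence this happens only if `e'` is a power of two modulo `Q -
1`. -/

/-- The additive character `z ↦ (-1) ^ z` of the prime field of characteristic two. -/
def signChar (R : Type*) [CommRing R] : AddChar (ZMod 2) R where
  toFun z := (-1) ^ z.val
  map_zero_eq_one' := by simp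
  map_add_eq_mul' a b := by
    have h : ∀ a b : ZMod 2, (a + b).val + 2 * (a.val * b.val) = a.val + b.val := by decide
    rw [← pow_add, ← h a b, pow_add, pow_mul]
    simp

/-- The additive character `x ↦ (-1) ^ Tr x` of a field of characteristic two. -/
noncomputable def traceChar (F R : Type*) [Field F] [Algebra (ZMod 2) F] [CommRing R] :
    AddChar F R :=
  (signChar R).compAddMonoidHom (Algebra.trace (ZMod 2) F).toAddMonoidHom

/-- The absolute trace, lifted to `{0, 1}`. -/
noncomputable def traceBit {F : Type*} [Field F] [Algebra (ZMod 2) F] (R : Type*) [CommRing R]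
    (x : F) : R :=
  ((Algebra.trace (ZMod 2) F x).val : R)

theorem traceChar_apply {F R : Type*} [Field F] [Algebra (ZMod 2) F] [CommRing R] (x : F) :
    traceChar F R x = (-1) ^ (Algebra.trace (ZMod 2) F x).val := rfl

theorem traceChar_eq_one_sub {F R : Type*} [Field F] [Algebra (ZMod 2) F] [CommRing R] (x : F) :
    traceChar F R x = 1 - 2 * traceBit R x := by
  rw [traceChar_apply, traceBit]
  generalize Algebra.trace (ZMod 2) F x = z
  fin_cases z
  · simp [ZMod.val]
  · norm_num [ZMod.val]

theorem map_traceChar {F R S : Type*} [Field F] [Algebra (ZMod 2) F] [CommRing R] [CommRing S]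
    (f : R →+* S) (x : F) : f (traceChar F R x) = traceChar F S x := by
  simp [traceChar_apply]

theorem traceChar_mul_self {F R : Type*} [Field F] [Algebra (ZMod 2) F] [CommRing R] (x : F) :
    traceChar F R x * traceChar F R x = 1 := by
  rw [traceChar_apply, ← pow_add, ← two_mul, pow_mul]
  simp

theorem sum_pow_eq {F : Type*} [Field F] [Fintype F] (m : ℕ) (hm : m ≠ 0) :
    ∑ x : F, x ^ m = if Fintype.card F - 1 ∣ m then -1 else 0 := by
  classical
  rw [← FiniteField.sum_pow_units F m, ← Fintype.sum_subtype_add_sum_subtype (fun x : F => x ≠ 0)]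
  have h1 : ∑ x : {x : F // ¬ x ≠ 0}, (x : F) ^ m = 0 :=
    sum_eq_zero fun x _ => by
      have := x.2
      simp only [ne_eq, not_not] at this
      simp [this, hm]
  rw [h1, add_zero]
  exact (Fintype.sum_equiv unitsEquivNeZero _ _ fun x => by simp).symm

/-! ### Gauss sums of the trace character -/

section Finite

variable {F : Type*} [Field F] [Fintype F] [Algebra (ZMod 2) F]

theorem charP_two_of_algebra (F : Type*) [Field F] [Algebra (ZMod 2) F] : CharP F 2 :=
  charP_of_injective_algebraMap (algebraMap (ZMod 2) F).injective 2

theorem card_eq_two_pow_finrank :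
    Fintype.card F = 2 ^ Module.finrank (ZMod 2) F := by
  simpa using Module.card_eq_pow_finrank (K := ZMod 2) (V := F)

theorem exists_trace_ne_zero : ∃ x : F, Algebra.trace (ZMod 2) F x ≠ 0 := by
  by_contra! h
  exact Algebra.trace_ne_zero (ZMod 2) F (LinearMap.ext h)

theorem algebraMap_trace_two (x : F) :
    algebraMap (ZMod 2) F (Algebra.trace (ZMod 2) F x) =
      ∑ i ∈ range (Module.finrank (ZMod 2) F), x ^ 2 ^ i := by
  simpa using FiniteField.algebraMap_trace_eq_sum_pow (ZMod 2) F x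

theorem trace_sq (x : F) :
    Algebra.trace (ZMod 2) F (x ^ 2) = Algebra.trace (ZMod 2) F x := by
  apply (algebraMap (ZMod 2) F).injective
  have hF := charP_two_of_algebra F
  have h0 : algebraMap (ZMod 2) F (Algebra.trace (ZMod 2) F x) ^ 2 =
      algebraMap (ZMod 2) F (Algebra.trace (ZMod 2) F x) := by
    rw [← map_pow]
    congr 1
    generalize Algebra.trace (ZMod 2) F x = z
    revert z
    decide
  rw [← h0, algebraMap_trace_two, algebraMap_trace_two, sum_pow_char]
  exact sum_congr rfl fun i _ => by rw [← pow_mul, ← pow_mul, mul_comm]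

theorem trace_pow_two_pow (x : F) (i : ℕ) :
    Algebra.trace (ZMod 2) F (x ^ 2 ^ i) = Algebra.trace (ZMod 2) F x := by
  induction i with
  | zero => simp
  | succ i ih => rw [pow_succ, pow_mul, trace_sq, ih]

theorem traceChar_ne_one {R : Type*} [CommRing R] (h2 : (2 : R) ≠ 0) : traceChar F R ≠ 1 := by
  obtain ⟨x, hx⟩ := exists_trace_ne_zero (F := F)
  intro h
  have h1 := DFunLike.congr_fun h x
  rw [traceChar_apply, AddChar.one_apply] at h1
  generalize Algebra.trace (ZMod 2) F x = z at hx h1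
  have hz : z = 1 := by
    clear h1
    revert z
    decide
  subst hz
  have h3 : (-1 : R) = 1 := by simpa [ZMod.val_one] using h1
  apply h2
  linear_combination -h3

theorem sum_traceChar_mul {R : Type*} [CommRing R] [IsDomain R] (h2 : (2 : R) ≠ 0)
    [DecidableEq F] (b : F) :
    ∑ x, traceChar F R (x * b) = if b = 0 then (Fintype.card F : R) else 0 :=
  by simpa using AddChar.sum_mulShift b (AddChar.IsPrimitive.of_ne_one (traceChar_ne_one h2))

/-- Since `φ` sums to zero, only the bit part of the character survives. This isolates an explicit
factor 2, so the remaining sum can be studied modulo 2. -/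
theorem gaussSum_traceChar {R : Type*} [CommRing R] [IsDomain R] {φ : MulChar F R} (hφ : φ ≠ 1) :
    gaussSum φ (traceChar F R) = -2 * ∑ x, traceBit R x * φ x := by
  have h := MulChar.sum_eq_zero_of_ne_one hφ
  rw [gaussSum, mul_sum, ← add_zero (∑ x, -2 * _), ← h, ← sum_add_distrib]
  exact sum_congr rfl fun x _ => by rw [traceChar_eq_one_sub]; ring

/-- Squaring permutes the field and preserves the absolute trace. -/
theorem gaussSum_sq_traceChar {R : Type*} [CommRing R] (φ : MulChar F R) :
    gaussSum (φ ^ 2) (traceChar F R) = gaussSum φ (traceChar F R) := by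
  have hF := charP_two_of_algebra F
  refine sum_bijective (fun x => x ^ 2) ?_ (by simp) fun x _ => ?_
  · exact Finite.injective_iff_bijective.mp (frobenius_inj F 2)
  · rw [MulChar.pow_apply' _ two_ne_zero, map_pow, traceChar_apply, traceChar_apply, trace_sq]

theorem gaussSum_mul_gaussSum_inv {R : Type*} [CommRing R] [IsDomain R] (h2 : (2 : R) ≠ 0)
    {φ : MulChar F R} (hφ : φ ≠ 1) :
    gaussSum φ (traceChar F R) * gaussSum φ⁻¹ (traceChar F R) = Fintype.card F := by
  have h := gaussSum_mul_gaussSum_eq_card hφ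
    (AddChar.IsPrimitive.of_ne_one (traceChar_ne_one (F := F) h2))
  have h1 : (traceChar F R)⁻¹ = traceChar F R := by
    refine inv_eq_of_mul_eq_one_left ?_
    ext x
    simpa using traceChar_mul_self x
  rwa [h1] at h

end Finite

/-! ### The Teichmüller character and Stickelberger's congruence modulo 2 -/

section Teichmuller

variable (F : Type*) [Field F]

/-- The Teichmüller character of a field of characteristic two. -/
noncomputable def teichmullerChar : MulChar F (WittVector 2 F) :=
  { teichmuller 2 with
    map_nonunit' := fun a ha => by
      have : a = 0 := by simpa using ha
      subst this
      exact teichmuller_zero 2 }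

theorem constantCoeff_teichmullerChar (x : F) :
    constantCoeff (teichmullerChar F x) = x :=
  teichmuller_coeff_zero 2 x

theorem two_ne_zero_wittVector [CharP F 2] : (2 : WittVector 2 F) ≠ 0 := by
  exact_mod_cast WittVector.p_nonzero 2 F

variable {F} [Fintype F]

theorem teichmullerChar_pow_eq_one_iff (m : ℕ) :
    teichmullerChar F ^ m = 1 ↔ Fintype.card F - 1 ∣ m := by
  classical
  rcases eq_or_ne m 0 with rfl | hm
  · simp
  constructor
  · intro h
    rw [← FiniteField.forall_pow_eq_one_iff F m]
    intro x
    have h1 := congr_arg constantCoeff (DFunLike.congr_fun h (x : F))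
    rw [MulChar.pow_apply' _ hm, map_pow, constantCoeff_teichmullerChar, MulChar.one_apply_coe,
      map_one] at h1
    exact Units.ext (by rw [Units.val_pow_eq_pow_val, h1, Units.val_one])
  · rintro ⟨c, rfl⟩
    rw [pow_mul, ← Fintype.card_units, MulChar.pow_card_eq_one, one_pow]

/-- Modulo 2 the trace bit is the polynomial `∑ x ^ (2 ^ i)` and the character is `x ^ m`, leaving
power sums over the field. -/
theorem constantCoeff_sum_traceBit_mul [Algebra (ZMod 2) F] (m : ℕ) (hm : m ≠ 0) :
    constantCoeff (∑ x, traceBit (WittVector 2 F) x * (teichmullerChar F ^ m) x) =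
      ∑ i ∈ range (Module.finrank (ZMod 2) F),
        if Fintype.card F - 1 ∣ 2 ^ i + m then (-1 : F) else 0 := by
  rw [map_sum]
  have h (x : F) : constantCoeff (traceBit (WittVector 2 F) x * (teichmullerChar F ^ m) x) =
      ∑ i ∈ range (Module.finrank (ZMod 2) F), x ^ (2 ^ i + m) := by
    rw [map_mul, MulChar.pow_apply' _ hm, map_pow, constantCoeff_teichmullerChar, traceBit,
      map_natCast]
    have h1 := algebraMap_trace_two x
    rw [← ZMod.natCast_zmod_val (Algebra.trace (ZMod 2) F x), map_natCast] at h1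
    rw [h1, sum_mul]
    simp only [pow_add]
  simp_rw [h]
  rw [sum_comm]
  exact sum_congr rfl fun i _ => sum_pow_eq _ (by positivity)

end Teichmuller

/-! ### Sums along the fibres of homomorphisms -/

theorem sum_comp_monoidHom {G H M : Type*} [Group G] [Fintype G] [Group H] [DecidableEq H]
    [AddCommMonoid M] (f : G →* H) (F : H → M) :
    ∑ g, F (f g) = Nat.card f.ker • ∑ h ∈ univ.image f, F h := by
  classical
  rw [sum_comp, smul_sum]
  refine sum_congr rfl fun h hh => ?_
  congr 1
  obtain ⟨g, -, rfl⟩ := mem_image.mp hh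
  rw [MonoidHom.card_fiber_eq_of_mem_range f (y := 1) ⟨g, rfl⟩ ⟨1, map_one f⟩,
    Nat.card_eq_fintype_card, Fintype.card_subtype]
  simp [MonoidHom.mem_ker]

theorem sum_comp_addMonoidHom {G H M : Type*} [AddGroup G] [Fintype G] [AddGroup H]
    [DecidableEq H] [AddCommMonoid M] (f : G →+ H) (F : H → M) :
    ∑ g, F (f g) = #{g | f g = 0} • ∑ h ∈ univ.image f, F h := by
  classical
  rw [sum_comp, smul_sum]
  refine sum_congr rfl fun h hh => ?_
  congr 1
  obtain ⟨g, -, rfl⟩ := mem_image.mp hh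
  exact AddMonoidHom.card_fiber_eq_of_mem_range f ⟨g, rfl⟩ ⟨0, map_zero f⟩

theorem norm_algebraMap_mul_of_finrank_two {K L : Type*} [Field K] [Field L] [Algebra K L]
    (h : Module.finrank K L = 2) (t : K) (x : L) :
    Algebra.norm K (algebraMap K L t * x) = t ^ 2 * Algebra.norm K x := by
  rw [map_mul, Algebra.norm_algebraMap, h]

theorem trace_algebraMap_mul {K L : Type*} [Field K] [Field L] [Algebra K L] (t : K) (x : L) :
    Algebra.trace K L (algebraMap K L t * x) = t * Algebra.trace K L x := by
  rw [← Algebra.smul_def, map_smul, smul_eq_mul]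

theorem sum_units_eq {F M : Type*} [Field F] [Fintype F] [DecidableEq F] [AddCommMonoid M]
    (f : F → M) :
    ∑ x, f x = f 0 + ∑ u : Fˣ, f u := by
  classical
  rw [← add_sum_erase univ f (mem_univ 0)]
  congr 1
  symm
  refine sum_bij (fun u _ => (u : F)) (by simp) (fun _ _ _ _ => Units.ext) ?_ (fun _ _ => rfl)
  intro b hb
  exact ⟨Units.mk0 b (mem_erase.mp hb).1, mem_univ _, rfl⟩

/-! ### Norm and trace in a quadratic extension, and Hasse–Davenport -/

section Quadratic

variable {K L : Type*} [Field K] [Fintype K] [Field L] [Fintype L] [Algebra K L]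

theorem algebraMap_trace_of_finrank_two (h : Module.finrank K L = 2) (x : L) :
    algebraMap K L (Algebra.trace K L x) = x + x ^ Fintype.card K := by
  rw [FiniteField.algebraMap_trace_eq_sum_pow, h]
  simp [sum_range_succ]

theorem algebraMap_norm_of_finrank_two (h : Module.finrank K L = 2) (x : L) :
    algebraMap K L (Algebra.norm K x) = x ^ (Fintype.card K + 1) := by
  rw [FiniteField.algebraMap_norm_eq_pow_sum, h]
  simp [sum_range_succ, add_comm]

theorem card_of_finrank_two (h : Module.finrank K L = 2) :
    Fintype.card L = Fintype.card K ^ 2 := by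
  rw [← h, Module.card_eq_pow_finrank (K := K) (V := L)]

theorem sum_comp_norm (h : Module.finrank K L = 2) [DecidableEq K] {M : Type*} [AddCommMonoid M]
    (f : K → M) :
    ∑ x : L, f (Algebra.norm K x) =
      f 0 + (Fintype.card K + 1) • ∑ u : Kˣ, f u := by
  classical
  have hs := FiniteField.unitsMap_norm_surjective K L
  have hcard (N : Lˣ →* Kˣ) (hN : Function.Surjective N) :
      Nat.card N.ker = Fintype.card K + 1 := by
    have h1 := N.ker.card_mul_index
    rw [Subgroup.index_ker, MonoidHom.range_eq_top.mpr hN, Subgroup.card_top,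
      Nat.card_eq_fintype_card (α := Kˣ), Nat.card_eq_fintype_card (α := Lˣ),
      Fintype.card_units, Fintype.card_units, card_of_finrank_two h] at h1
    have h2 : 1 < Fintype.card K := Fintype.one_lt_card
    refine Nat.eq_of_mul_eq_mul_right (Nat.sub_pos_of_lt h2) (h1.trans ?_)
    rw [← Nat.sq_sub_sq, one_pow]
  rw [sum_units_eq, Algebra.norm_zero]
  congr 1
  have h3 := sum_comp_monoidHom (Units.map (Algebra.norm K (S := L))) (fun u : Kˣ => f u)
  rw [hcard _ hs, image_univ_of_surjective hs] at h3
  exact h3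

theorem card_trace_eq (h : Module.finrank K L = 2) [DecidableEq K] (t : K) :
    #{x : L | Algebra.trace K L x = t} = Fintype.card K := by
  classical
  have hs : Function.Surjective (Algebra.trace K L) := Algebra.trace_surjective K L
  have h1 (f : K → ℕ) := sum_comp_addMonoidHom (Algebra.trace K L).toAddMonoidHom f
  simp only [LinearMap.toAddMonoidHom_coe, image_univ_of_surjective hs] at h1
  have h2 := h1 fun _ => 1
  simp only [sum_const, card_univ, smul_eq_mul, mul_one, card_of_finrank_two h, sq] at h2
  have h3 := h1 fun s => if s = t then 1 else 0
  rw [← card_filter] at h3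
  rw [h3, sum_ite_eq' univ t]
  simp only [mem_univ, if_true, smul_eq_mul, mul_one]
  exact (Nat.eq_of_mul_eq_mul_right Fintype.card_pos h2).symm

variable [Algebra (ZMod 2) K]

/-- The conjugate of `z` is `z + 1`, so the norm is `z ^ 2 + z` and its absolute trace telescopes to
`z ^ Q - z = 1`. -/
theorem trace_norm_of_trace_eq_one (h : Module.finrank K L = 2) {z : L}
    (hz : Algebra.trace K L z = 1) : Algebra.trace (ZMod 2) K (Algebra.norm K z) = 1 := by
  have hK := charP_two_of_algebra K
  have hL : CharP L 2 := charP_of_injective_algebraMap (algebraMap K L).injective 2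
  apply (algebraMap (ZMod 2) K).injective
  apply (algebraMap K L).injective
  have hq : z ^ Fintype.card K = z + 1 := by
    have := algebraMap_trace_of_finrank_two h z
    rw [hz, map_one] at this
    linear_combination -this - CharTwo.add_self_eq_zero z
  rw [algebraMap_trace_two, map_sum]
  simp only [map_pow, algebraMap_norm_of_finrank_two h, pow_succ (z) (Fintype.card K), hq,
    map_one]
  have h1 (i : ℕ) : ((z + 1) * z) ^ 2 ^ i = z ^ 2 ^ (i + 1) - z ^ 2 ^ i := by
    rw [add_mul, one_mul, add_pow_char_pow, ← sq, ← pow_mul, ← pow_succ', CharTwo.sub_eq_add]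
  simp_rw [h1]
  rw [sum_range_sub (fun i => z ^ 2 ^ i), ← card_eq_two_pow_finrank, hq]
  simp

/-- Each fibre is empty or contained in `{z, z + 1}`, and is empty unless `w` has absolute trace 1.
Both sides have total `|K|` over all `w`, so the pointwise bound is an equality. -/
theorem card_norm_eq_trace_eq_one (h : Module.finrank K L = 2) [DecidableEq K] (w : K) :
    #{x : L | Algebra.trace K L x = 1 ∧ Algebra.norm K x = w} =
      2 * (Algebra.trace (ZMod 2) K w).val := by
  classical
  have hK := charP_two_of_algebra K
  have hL : CharP L 2 := charP_of_injective_algebraMap (algebraMap K L).injective 2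
  have hle (w : K) : #{x : L | Algebra.trace K L x = 1 ∧ Algebra.norm K x = w} ≤
      2 * (Algebra.trace (ZMod 2) K w).val := by
    rcases eq_empty_or_nonempty {x : L | Algebra.trace K L x = 1 ∧ Algebra.norm K x = w}
      with h0 | ⟨z, hz⟩
    · simp [h0]
    obtain ⟨hz1, hz2⟩ := (mem_filter.mp hz).2
    rw [← hz2, trace_norm_of_trace_eq_one h hz1, hz2, ZMod.val_one]
    refine (card_le_card (t := {z, z + 1}) fun y hy => ?_).trans card_le_two
    obtain ⟨hy1, hy2⟩ := (mem_filter.mp hy).2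
    have hsq (y : L) (hy1 : Algebra.trace K L y = 1) :
        algebraMap K L (Algebra.norm K y) = y ^ 2 + y := by
      have := algebraMap_trace_of_finrank_two h y
      rw [hy1, map_one] at this
      rw [algebraMap_norm_of_finrank_two h, pow_succ]
      linear_combination (-y) * this - y ^ 2 * CharTwo.two_eq_zero (R := L)
    have h1 : y ^ 2 + y = z ^ 2 + z := by rw [← hsq y hy1, ← hsq z hz1, hy2, hz2]
    have h2 : (y - z) * (y - (z + 1)) = 0 := by
      linear_combination h1 - (z * y - z ^ 2 - z + y) * CharTwo.two_eq_zero (R := L)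
    rcases mul_eq_zero.mp h2 with h3 | h3
    · simp [sub_eq_zero.mp h3]
    · simp [sub_eq_zero.mp h3]
  have hsum : ∑ w, #{x : L | Algebra.trace K L x = 1 ∧ Algebra.norm K x = w} =
      ∑ w : K, 2 * (Algebra.trace (ZMod 2) K w).val := by
    have h1 : ∑ w, #{x : L | Algebra.trace K L x = 1 ∧ Algebra.norm K x = w} =
        Fintype.card K := by
      rw [← card_trace_eq h (1 : K), card_eq_sum_card_fiberwise
        (f := Algebra.norm K (S := L)) (t := univ) (by simp)]
      simp [filter_filter]
    have h2 := AddChar.sum_eq_zero_of_ne_one (traceChar_ne_one (F := K) (R := ℤ) two_ne_zero)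
    simp only [traceChar_eq_one_sub, sum_sub_distrib, traceBit] at h2
    rw [h1]
    zify
    simp only [sum_const, card_univ, nsmul_eq_mul, mul_one] at h2
    linarith
  exact (sum_eq_sum_iff_of_le fun w _ => hle w).mp hsum w (mem_univ w)

/-- A quadratic instance of the Hasse-Davenport relation. -/
theorem sum_mulChar_norm_mul_traceChar (h : Module.finrank K L = 2)
    {R : Type*} [CommRing R] [IsDomain R] {φ : MulChar K R} (hφ : φ ^ 2 ≠ 1) :
    ∑ x : L, φ (Algebra.norm K x) * traceChar K R (Algebra.trace K L x) =
      gaussSum φ (traceChar K R) * (2 * ∑ w, traceBit R w * φ w) := by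
  classical
  have hJ : ∑ x : L with Algebra.trace K L x = 1, φ (Algebra.norm K x) =
      2 * ∑ w, traceBit R w * φ w := by
    rw [← sum_fiberwise _ (Algebra.norm K (S := L)), mul_sum]
    refine sum_congr rfl fun w _ => ?_
    rw [filter_filter, sum_congr rfl (g := fun _ => φ w)
      fun x hx => by rw [(mem_filter.mp hx).2.2], sum_const, card_norm_eq_trace_eq_one h,
      nsmul_eq_mul, traceBit]
    push_cast
    ring
  -- Multiplication by `t` carries one trace slice to another and multiplies norms by `t ^ 2`,
  -- whence `φ ^ 2`. For `s = 0` this forces the slice sum to vanish, as `φ ^ 2 ≠ 1`.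
  have hscale (t : Kˣ) (s : K) :
      ∑ x : L with Algebra.trace K L x = t * s, φ (Algebra.norm K x) =
        (φ ^ 2) t * ∑ x : L with Algebra.trace K L x = s, φ (Algebra.norm K x) := by
    rw [mul_sum]
    have ht : algebraMap K L t ≠ 0 := by simp
    symm
    refine sum_bij (fun x _ => algebraMap K L t * x) ?_ ?_ ?_ ?_
    · intro x hx
      simp only [mem_filter, mem_univ, true_and] at hx ⊢
      rw [trace_algebraMap_mul, hx]
    · intro x _ y _ hxy
      exact mul_left_cancel₀ ht hxy
    · intro y hy
      simp only [mem_filter, mem_univ, true_and] at hy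
      refine ⟨algebraMap K L (↑t⁻¹ : K) * y, ?_, ?_⟩
      · simp only [mem_filter, mem_univ, true_and]
        rw [trace_algebraMap_mul, hy, Units.inv_mul_cancel_left]
      · rw [← mul_assoc, ← map_mul]
        simp
    · intro x _
      rw [norm_algebraMap_mul_of_finrank_two h, map_mul, MulChar.pow_apply_coe, map_pow]
  have h0 : ∑ x : L with Algebra.trace K L x = 0, φ (Algebra.norm K x) = 0 := by
    obtain ⟨c, hc⟩ := MulChar.ne_one_iff.mp hφ
    have h1 := hscale c 0
    rw [mul_zero] at h1
    by_contra h2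
    exact hc (mul_right_cancel₀ h2 (by rw [← h1, one_mul]))
  -- Slicing by trace produces the Gauss sum of `φ ^ 2`, which equals that of `φ`.
  rw [← gaussSum_sq_traceChar, gaussSum, sum_mul,
    ← sum_fiberwise _ (Algebra.trace K L)]
  refine sum_congr rfl fun t _ => ?_
  rw [sum_congr rfl (g := fun x : L => φ (Algebra.norm K x) * traceChar K R t)
    fun x hx => by rw [(mem_filter.mp hx).2], ← sum_mul]
  rcases eq_or_ne t 0 with rfl | ht
  · rw [h0, MulChar.map_zero]
    ring
  · have h1 := hscale (Units.mk0 t ht) 1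
    rw [mul_one, Units.val_mk0, hJ] at h1
    rw [h1]
    ring

end Quadratic

theorem sum_mulChar_norm
    {K L : Type*} [Field K] [Fintype K] [Field L] [Fintype L] [Algebra K L]
    (h : Module.finrank K L = 2) {R : Type*} [CommRing R] [IsDomain R]
    {φ : MulChar K R} (hφ : φ ≠ 1) : ∑ x : L, φ (Algebra.norm K x) = 0 := by
  classical
  have h1 := MulChar.sum_eq_zero_of_ne_one hφ
  rw [sum_units_eq, MulChar.map_zero, zero_add] at h1
  rw [sum_comp_norm h, h1, MulChar.map_zero, smul_zero, add_zero]

/-! ### The exponent of the norm is a power of two -/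

section Forward

variable {K L : Type*} [Field K] [Fintype K] [Field L] [Fintype L] [Algebra K L]
  [Algebra (ZMod 2) K]

/-- Here `m = Q - 2`, and among `0 ≤ i < k` only `i = 0` makes `2 ^ i + m` divisible by `Q - 1`. -/
theorem constantCoeff_sum_traceBit_mul_teichmullerChar_inv [CharP K 2]
    (hK : 2 < Fintype.card K) :
    constantCoeff (∑ x, traceBit (WittVector 2 K) x * (teichmullerChar K)⁻¹ x) = -1 := by
  have h1 : (teichmullerChar K)⁻¹ = teichmullerChar K ^ (Fintype.card K - 2) := by
    refine inv_eq_of_mul_eq_one_right ?_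
    rw [← pow_succ', teichmullerChar_pow_eq_one_iff]
    exact dvd_of_eq (by omega)
  rw [h1, constantCoeff_sum_traceBit_mul _ (by omega)]
  have hk : 0 < Module.finrank (ZMod 2) K := Module.finrank_pos
  rw [sum_eq_single_of_mem 0 (mem_range.mpr hk), if_pos (dvd_of_eq (by omega))]
  intro i hi hi0
  refine if_neg fun hdvd => ?_
  have h2 : 1 < 2 ^ i := Nat.one_lt_two_pow hi0
  have h3 : 2 ^ i < Fintype.card K := by
    rw [card_eq_two_pow_finrank]
    exact Nat.pow_lt_pow_right (by norm_num) (mem_range.mp hi)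
  have h4 : 2 ^ i + (Fintype.card K - 2) = (Fintype.card K - 1) + (2 ^ i - 1) := by omega
  rw [h4, Nat.dvd_add_right dvd_rfl] at hdvd
  exact absurd (Nat.le_of_dvd (by omega) hdvd) (by omega)

theorem sum_mulChar_norm_inv_mul_traceChar_mul (h : Module.finrank K L = 2)
    {R : Type*} [CommRing R] [IsDomain R] {φ : MulChar K R} (hφ : φ ≠ 1) (x : L) :
    ∑ l : L, φ⁻¹ (Algebra.norm K l) * traceChar K R (Algebra.trace K L (l * x)) =
      φ (Algebra.norm K x) *
        ∑ l : L, φ⁻¹ (Algebra.norm K l) * traceChar K R (Algebra.trace K L l) := by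
  rcases eq_or_ne x 0 with rfl | hx
  · simp [sum_mulChar_norm h (inv_ne_one.mpr hφ), MulChar.map_zero]
  · rw [mul_sum]
    refine Fintype.sum_equiv (Equiv.mulRight₀ x hx) _ _ fun l => ?_
    have hN : Algebra.norm K x ≠ 0 := Algebra.norm_ne_zero_iff.mpr hx
    have h1 : φ (Algebra.norm K x) * φ⁻¹ (Algebra.norm K x) = 1 := by
      rw [← MulChar.mul_apply, mul_inv_cancel, MulChar.one_apply hN.isUnit]
    rw [Equiv.mulRight₀_apply, map_mul (Algebra.norm K), map_mul (φ⁻¹)]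
    linear_combination (-(φ⁻¹ (Algebra.norm K l) *
      traceChar K R (Algebra.trace K L (l * x)))) * h1

/-- Substitute `v = b * u ^ e`, a permutation of the units; then `φ u ^ (e * e') = φ u` turns the
sum into a Gauss sum of `φ ^ e'`. -/
theorem sum_units_mulChar_mul_traceChar_pow [DecidableEq K] {R : Type*} [CommRing R]
    (φ : MulChar K R) {b : K} (hb : b ≠ 0) {e e' : ℕ} (he' : e' ≠ 0)
    (hee : e * e' ≡ 1 [MOD Fintype.card K - 1]) :
    φ b ^ e' * ∑ u : Kˣ, φ u * traceChar K R (b * u ^ e) =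
      gaussSum (φ ^ e') (traceChar K R) := by
  have hu (u : Kˣ) : (u ^ e) ^ e' = u := by
    rw [← pow_mul]
    conv_rhs => rw [← pow_one u]
    exact pow_eq_pow_iff_modEq.mpr
      (hee.of_dvd (by rw [← Fintype.card_units]; exact orderOf_dvd_card))
  have hbij : Function.Bijective fun u : Kˣ => Units.mk0 b hb * u ^ e := by
    refine Finite.injective_iff_bijective.mp fun u v huv => ?_
    rw [← hu u, ← hu v, mul_left_cancel huv]
  rw [gaussSum, sum_units_eq (fun a => (φ ^ e') a * traceChar K R a), MulChar.map_zero, zero_mul,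
    zero_add, mul_sum]
  refine hbij.sum_comp (fun u : Kˣ => (φ ^ e') u * traceChar K R u) |>.symm.trans ?_ |>.symm
  refine sum_congr rfl fun u _ => ?_
  conv_rhs => rw [← hu u]
  simp only [MulChar.pow_apply' _ he', Units.val_mul, Units.val_mk0, Units.val_pow_eq_pow_val,
    map_mul, map_pow, mul_pow, ← mul_assoc]
  rw [← Units.val_pow_eq_pow_val, ← Units.val_pow_eq_pow_val, hu, Units.val_pow_eq_pow_val]

theorem exists_modEq_two_pow_of_traceChar_sum (h : Module.finrank K L = 2)
    (hK : 2 < Fintype.card K) {b : K} (hb : b ≠ 0) {e : ℕ}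
    (he : e.Coprime (Fintype.card K - 1))
    (hW : ∀ l : L,
      ∑ x : L, traceChar K ℤ (b * Algebra.norm K x ^ e + Algebra.trace K L (l * x)) =
          Fintype.card K ∨
        ∑ x : L, traceChar K ℤ (b * Algebra.norm K x ^ e + Algebra.trace K L (l * x)) =
          -Fintype.card K) :
    ∃ i, e ≡ 2 ^ i [MOD Fintype.card K - 1] := by
  classical
  have hchar := charP_two_of_algebra K
  set Q := Fintype.card K with hQ
  have h2 : (2 : (WittVector 2 K)) ≠ 0 := two_ne_zero_wittVector K
  have hQk : Q = 2 ^ Module.finrank (ZMod 2) K := card_eq_two_pow_finrank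
  have hQ0 : (Q : (WittVector 2 K)) ≠ 0 := by
    rw [hQk]
    rw [Nat.cast_pow]
    exact pow_ne_zero _ h2
  have hQ3 : 1 < Q - 1 := by omega
  obtain ⟨e', -, hee'⟩ := Nat.exists_mul_mod_eq_one_of_coprime he hQ3
  have hee : e * e' ≡ 1 [MOD Q - 1] := by rw [Nat.ModEq, hee', Nat.mod_eq_of_lt hQ3]
  have he'dvd : ¬ Q - 1 ∣ e' := fun hd => by
    have := Nat.mod_eq_zero_of_dvd (hd.mul_left e)
    omega
  have he'0 : e' ≠ 0 := fun h0 => he'dvd (h0 ▸ dvd_zero _)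
  set ω := teichmullerChar K with hω
  set χ := traceChar K (WittVector 2 K) with hχ
  have hω1 : ω ≠ 1 := by
    have := (teichmullerChar_pow_eq_one_iff (F := K) 1).not.mpr
      (by rw [Nat.dvd_one]; omega)
    rwa [pow_one] at this
  have hω2 : ω⁻¹ ^ 2 ≠ 1 := by
    rw [inv_pow, inv_ne_one]
    -- With `Q > 2`, divisibility would force `Q = 3`, which parity excludes.
    refine (teichmullerChar_pow_eq_one_iff (F := K) 2).not.mpr fun hd => ?_
    have h3 := Nat.le_of_dvd two_pos hd
    have h4 : Even Q := by
      rw [hQk]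
      exact (Nat.even_pow.mpr ⟨even_two, Module.finrank_pos.ne'⟩)
    obtain ⟨c, hc⟩ := h4
    omega
  have hωe : ω ^ e' ≠ 1 := (teichmullerChar_pow_eq_one_iff (F := K) e').not.mpr he'dvd
  set V := ∑ x, traceBit (WittVector 2 K) x * ω⁻¹ x with hV
  set V' := ∑ x, traceBit (WittVector 2 K) x * (ω ^ e')⁻¹ x with hV'
  set Γ := ∑ l : L, ω⁻¹ (Algebra.norm K l) * χ (Algebra.trace K L l) with hΓ
  have hΓ1 : Γ = -4 * V ^ 2 := by
    rw [hΓ, sum_mulChar_norm_mul_traceChar h hω2, gaussSum_traceChar (inv_ne_one.mpr hω1)]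
    ring
  have hW' : ∀ l : L, ∃ t : (WittVector 2 K),
      ∑ x : L, χ (b * Algebra.norm K x ^ e + Algebra.trace K L (l * x)) = Q * (1 - 2 * t) := by
    intro l
    have h3 : ∑ x : L, χ (b * Algebra.norm K x ^ e + Algebra.trace K L (l * x)) =
        Int.castRingHom (WittVector 2 K)
          (∑ x : L, traceChar K ℤ (b * Algebra.norm K x ^ e + Algebra.trace K L (l * x))) := by
      simp only [map_sum, map_traceChar, hχ]
    rcases hW l with h4 | h4
    · exact ⟨0, by rw [h3, h4]; simp⟩
    · exact ⟨1, by rw [h3, h4]; simp; ring⟩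
  choose t ht using hW'
  set H := ∑ l : L, ω⁻¹ (Algebra.norm K l) * t l with hH
  set A := ∑ u : Kˣ, ω u * χ (b * u ^ e) with hA
  have hA1 : ω b ^ e' * A = gaussSum (ω ^ e') χ :=
    sum_units_mulChar_mul_traceChar_pow ω hb he'0 hee
  -- The constant part of `Q * (1 - 2 * t l)` disappears because `ω⁻¹ ∘ N` sums to zero. Exchanging
  -- the sums on the other side gives the Gauss sum `Γ`, and each nonzero norm is attained `Q + 1`
  -- times.
  have key : -2 * Q * H = (Q + 1) * A * Γ := by
    calc -2 * Q * H
        = ∑ l : L, ω⁻¹ (Algebra.norm K l) *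
            ∑ x : L, χ (b * Algebra.norm K x ^ e + Algebra.trace K L (l * x)) := by
          simp only [ht]
          have h3 := sum_mulChar_norm h (inv_ne_one.mpr hω1)
          rw [hH, mul_sum, ← add_zero (∑ l : L, -2 * _ * _), ← mul_zero (Q : WittVector 2 K),
            ← h3, mul_sum,
            ← sum_add_distrib]
          exact sum_congr rfl fun l _ => by ring
      _ = ∑ x : L, χ (b * Algebra.norm K x ^ e) * (ω (Algebra.norm K x) * Γ) := by
          simp only [mul_sum]
          rw [sum_comm]
          refine sum_congr rfl fun x _ => ?_
          rw [hΓ, ← sum_mulChar_norm_inv_mul_traceChar_mul h hω1, mul_sum]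
          refine sum_congr rfl fun l _ => ?_
          rw [AddChar.map_add_eq_mul]
          ring
      _ = (∑ x : L, ω (Algebra.norm K x) * χ (b * Algebra.norm K x ^ e)) * Γ := by
          rw [sum_mul]
          exact sum_congr rfl fun x _ => by ring
      _ = (Q + 1) * A * Γ := by
          rw [sum_comp_norm h (fun y => ω y * χ (b * y ^ e)), MulChar.map_zero, zero_mul,
            zero_add, nsmul_eq_mul]
          push_cast
          rfl
  have hGG := gaussSum_mul_gaussSum_inv h2 hωe
  rw [gaussSum_traceChar (inv_ne_one.mpr hωe)] at hGG
  -- Multiplying `key` by the complementary Gauss sum `-2 * V'` produces a factor `Q`; then `4 * Q`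
  -- cancels since the Witt vectors form a domain in which 2 is nonzero.
  have key2 : H * ω b ^ e' * V' = -(Q + 1) * V ^ 2 := by
    have h3 : (4 * Q : (WittVector 2 K)) * (H * ω b ^ e' * V') = (4 * Q) * (-(Q + 1) * V ^ 2) := by
      linear_combination (ω b ^ e' * (-2 * V')) * key + (Q + 1) * Γ * (-2 * V') * hA1 +
        (Q + 1) * Γ * hGG + (Q + 1) * Q * hΓ1
    refine mul_left_cancel₀ (mul_ne_zero ?_ hQ0) h3
    have : (4 : (WittVector 2 K)) = 2 * 2 := by norm_num
    rw [this]
    exact mul_ne_zero h2 h2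
  -- Modulo 2, `Q` vanishes and `V` becomes `-1`, so the right side of `key2` is nonzero.
  have hV'0 : constantCoeff V' ≠ 0 := by
    intro h0
    have h3 := congr_arg constantCoeff key2
    have hQ1 : (Q : K) = 0 := by rw [hQ]; exact FiniteField.cast_card_eq_zero K
    rw [map_mul, h0, mul_zero, map_mul, map_pow, hV,
      constantCoeff_sum_traceBit_mul_teichmullerChar_inv hK, map_neg, map_add, map_natCast,
      hQ1] at h3
    simp at h3
  have hinv : (ω ^ e')⁻¹ = ω ^ ((Q - 2) * e') := by
    refine inv_eq_of_mul_eq_one_right ?_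
    rw [← pow_add, teichmullerChar_pow_eq_one_iff]
    refine ⟨e', ?_⟩
    rw [add_comm, ← Nat.succ_mul]
    congr 1
    omega
  rw [hV', hinv, constantCoeff_sum_traceBit_mul _ (mul_ne_zero (by omega) he'0)] at hV'0
  obtain ⟨i, hi, hi1⟩ := exists_ne_zero_of_sum_ne_zero hV'0
  have hdvd : Q - 1 ∣ 2 ^ i + (Q - 2) * e' := by
    by_contra h3
    exact hi1 (if_neg h3)
  have he'i : e' ≡ 2 ^ i [MOD Q - 1] := by
    have h3 : (2 ^ i + (Q - 2) * e') + e' = 2 ^ i + (Q - 1) * e' := by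
      rw [add_assoc, ← Nat.succ_mul]
      congr 2
      omega
    have h4 : (2 ^ i + (Q - 2) * e') + e' ≡ 0 + e' [MOD Q - 1] :=
      ((Nat.modEq_zero_iff_dvd).mpr hdvd).add_right e'
    have h5 : 2 ^ i + (Q - 1) * e' ≡ 2 ^ i + 0 [MOD Q - 1] :=
      ((Nat.modEq_zero_iff_dvd).mpr (dvd_mul_right _ _)).add_left _
    rw [h3, zero_add] at h4
    exact h4.symm.trans h5
  have hki : i ≤ Module.finrank (ZMod 2) K := (mem_range.mp hi).le
  have h2k : 2 ^ Module.finrank (ZMod 2) K ≡ 1 [MOD Q - 1] := by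
    rw [← hQk]
    exact ((Nat.modEq_iff_dvd' (by omega)).mpr dvd_rfl).symm
  -- As `2 ^ k ≡ 1`, the inverse of `2 ^ i` is `2 ^ (k - i)`.
  refine ⟨Module.finrank (ZMod 2) K - i, ?_⟩
  calc e = e * 1 := (mul_one e).symm
    _ ≡ e * 2 ^ Module.finrank (ZMod 2) K [MOD Q - 1] := (h2k.symm).mul_left e
    _ = e * 2 ^ i * 2 ^ (Module.finrank (ZMod 2) K - i) := by
        rw [mul_assoc, ← pow_add, Nat.add_sub_cancel' hki]
    _ ≡ e * e' * 2 ^ (Module.finrank (ZMod 2) K - i) [MOD Q - 1] :=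
        (he'i.symm.mul_left e).mul_right _
    _ ≡ 1 * 2 ^ (Module.finrank (ZMod 2) K - i) [MOD Q - 1] := hee.mul_right _
    _ = 2 ^ (Module.finrank (ZMod 2) K - i) := one_mul _

end Forward

/-! ### The gcd of the exponent with the order of the multiplicative group -/

section BentMonomials

variable {L : Type*} [Field L] [Fintype L] [Algebra (ZMod 2) L]

theorem hadamard_component (F : L → L) (a l : L) :
    hadamard (component F a) l = ∑ x, traceChar L ℤ (a * F x + l * x) := by
  refine sum_congr rfl fun x _ => ?_
  rw [traceChar_apply, map_add]
  rfl

/-- The substitution `x ↦ u * x` only rescales the argument of the transform. -/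
theorem isBent_component_pow_mul (k d : ℕ) (a : L) (u : Lˣ) :
    IsBent k (component (fun x : L => x ^ d) (a * u ^ d)) ↔
      IsBent k (component (fun x : L => x ^ d) a) := by
  have h (a : L) (u : Lˣ) (l : L) : hadamard (component (fun x : L => x ^ d) (a * u ^ d)) l =
      hadamard (component (fun x : L => x ^ d) a) (l * (↑u⁻¹ : L)) := by
    rw [hadamard_component, hadamard_component]
    refine Fintype.sum_equiv u.mulLeft _ _ fun x => ?_
    rw [Units.mulLeft_apply]
    congr 2
    · ring
    · rw [mul_assoc, Units.inv_mul_cancel_left]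
  constructor
  · intro hb l
    have := hb (l * u)
    rwa [h, Units.mul_inv_cancel_right] at this
  · intro hb l
    rw [h]
    exact hb _

/-- The term `x = 0` contributes 1; the units contribute in fibres of `u ↦ u ^ d`, all of the same
size. -/
theorem dvd_hadamard_zero_sub_one (d : ℕ) (hd : d ≠ 0) (a : L) :
    ((Nat.card (powMonoidHom d : Lˣ →* Lˣ).ker : ℕ) : ℤ) ∣
      hadamard (component (fun x : L => x ^ d) a) 0 - 1 := by
  classical
  have h := sum_comp_monoidHom (powMonoidHom d : Lˣ →* Lˣ) fun u : Lˣ => traceChar L ℤ (a * u)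
  rw [hadamard_component, sum_units_eq]
  simp only [zero_mul, add_zero, zero_pow hd, mul_zero, AddChar.map_zero_eq_one]
  rw [add_sub_cancel_left]
  rw [nsmul_eq_mul] at h
  refine Dvd.intro _ (h.symm.trans ?_)
  exact sum_congr rfl fun u _ => by rw [powMonoidHom_apply, Units.val_pow_eq_pow_val]

theorem card_powMonoidHom_range_dvd (k d : ℕ) :
    Nat.card (powMonoidHom d : Lˣ →* Lˣ).range ∣
      {u : Lˣ | ¬ IsBent k (component (fun x : L => x ^ d) (u : L))}.ncard := by
  set D := (powMonoidHom d : Lˣ →* Lˣ).range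
  set S := {u : Lˣ | ¬ IsBent k (component (fun x : L => x ^ d) (u : L))} with hS
  have h1 : S * (D : Set Lˣ) = S := by
    ext v
    constructor
    · rintro ⟨u, hu, _, ⟨w, rfl⟩, rfl⟩
      rw [hS, Set.mem_ofPred_eq] at hu ⊢
      simpa [isBent_component_pow_mul] using hu
    · intro hv
      exact ⟨v, hv, 1, D.one_mem, mul_one v⟩
  have h2 := Subgroup.card_mul_eq_card_subgroup_mul_card_quotient D S
  rw [h1] at h2
  exact ⟨_, h2⟩

theorem not_isBent_component_zero (k : ℕ) (hk : 1 ≤ k) (hL : Fintype.card L = 2 ^ (2 * k))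
    (F : L → L) : ¬ IsBent k (component F 0) := by
  intro h
  have h0 : hadamard (component F 0) 0 = (2 ^ k) ^ 2 := by
    rw [hadamard_component]
    simp [AddChar.map_zero_eq_one, hL, pow_mul, mul_comm]
  have h2 : (2 : ℤ) ≤ 2 ^ k := le_self_pow₀ (by norm_num) (by omega)
  rcases h 0 with h1 | h1 <;> rw [h0] at h1 <;> nlinarith

theorem ncard_not_isBent_units (k : ℕ) (hk : 1 ≤ k) (hL : Fintype.card L = 2 ^ (2 * k)) (d : ℕ)
    (h : numBentComponents k (fun x : L => x ^ d) = 2 ^ (2 * k) - 2 ^ k) :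
    {u : Lˣ | ¬ IsBent k (component (fun x : L => x ^ d) (u : L))}.ncard = 2 ^ k - 1 := by
  set S := {u : Lˣ | ¬ IsBent k (component (fun x : L => x ^ d) (u : L))} with hS
  have h1 : {a : L | IsBent k (component (fun x : L => x ^ d) a)}ᶜ =
      insert 0 ((fun u : Lˣ => (u : L)) '' S) := by
    ext a
    rcases eq_or_ne a 0 with rfl | ha
    · simpa using not_isBent_component_zero k hk hL _
    · simp only [Set.mem_compl_iff, Set.mem_ofPred_eq, Set.mem_insert_iff, ha, false_or,
        Set.mem_image, hS]
      constructor
      · intro hb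
        exact ⟨Units.mk0 a ha, hb, rfl⟩
      · rintro ⟨u, hu, rfl⟩
        exact hu
  have h2 := Set.ncard_add_ncard_compl {a : L | IsBent k (component (fun x : L => x ^ d) a)}
  rw [h1, Set.ncard_insert_of_notMem (by simp), Set.ncard_image_of_injective _ Units.val_injective,
    Nat.card_eq_fintype_card, hL] at h2
  rw [numBentComponents] at h
  have h3 : 2 ^ k ≤ 2 ^ (2 * k) := Nat.pow_le_pow_right (by norm_num) (by omega)
  omega

theorem gcd_eq_of_numBentComponents (k : ℕ) (hk : 1 ≤ k) (hL : Fintype.card L = 2 ^ (2 * k))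
    (d : ℕ) (hd0 : 0 < d) (h : numBentComponents k (fun x : L => x ^ d) = 2 ^ (2 * k) - 2 ^ k) :
    (2 ^ (2 * k) - 1).gcd d = 2 ^ k + 1 := by
  set Q := 2 ^ k with hQ
  have hQ2 : 2 ≤ Q := by
    rw [hQ]
    exact le_self_pow₀ (by norm_num) (by omega)
  have hq : 2 ^ (2 * k) - 1 = (Q + 1) * (Q - 1) := by
    rw [← Nat.sq_sub_sq, one_pow, hQ, ← pow_mul, mul_comm]
  classical
  have hker := IsCyclic.card_powMonoidHom_ker (G := Lˣ) d
  rw [Nat.card_eq_fintype_card (α := Lˣ), Fintype.card_units, hL] at hker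
  obtain ⟨c, hc⟩ := card_powMonoidHom_range_dvd (L := L) k d
  rw [ncard_not_isBent_units k hk hL d h] at hc
  have h1 := (powMonoidHom d : Lˣ →* Lˣ).ker.card_mul_index
  rw [Subgroup.index_ker, hker, Nat.card_eq_fintype_card (α := Lˣ), Fintype.card_units, hL] at h1
  set g := (2 ^ (2 * k) - 1).gcd d with hg
  set D := Nat.card (powMonoidHom d : Lˣ →* Lˣ).range
  have hD : 0 < D := Nat.card_pos
  -- With `D` the number of `d`-th powers, `g * D = (Q + 1) * (Q - 1)` and `D * c = Q - 1`, so `g =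
  -- (Q + 1) * c`.
  have hgdvd : Q + 1 ∣ g := by
    refine ⟨c, Nat.eq_of_mul_eq_mul_right hD ?_⟩
    rw [h1, hq, mul_assoc, mul_comm c, ← hc]
  obtain ⟨a, ha⟩ : ∃ a : L, IsBent k (component (fun x : L => x ^ d) a) := by
    by_contra! hne
    have h2 : numBentComponents k (fun x : L => x ^ d) = 0 := by
      simp [numBentComponents, hne]
    rw [h2] at h
    have : Q < 2 ^ (2 * k) := Nat.pow_lt_pow_right (by norm_num) (by omega)
    omega
  have h3 := dvd_hadamard_zero_sub_one d hd0.ne' a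
  rw [hker] at h3
  -- A bent component has value `±Q` at `0`, so `g` divides `Q - 1` or `Q + 1`.
  have hle : g ≤ Q + 1 := by
    rcases ha 0 with h4 | h4
    · rw [h4] at h3
      have h5 : (2 ^ k : ℤ) - 1 = ((Q - 1 : ℕ) : ℤ) := by
        rw [Nat.cast_sub (by omega : 1 ≤ Q), hQ]
        push_cast
        rfl
      rw [h5] at h3
      exact (Nat.le_of_dvd (by omega) (Int.natCast_dvd_natCast.mp h3)).trans (by omega)
    · rw [h4] at h3
      have h5 : -(2 ^ k : ℤ) - 1 = -((Q + 1 : ℕ) : ℤ) := by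
        push_cast [hQ]
        ring
      rw [h5, Int.dvd_neg] at h3
      exact Nat.le_of_dvd (by omega) (Int.natCast_dvd_natCast.mp h3)
  exact le_antisymm hle (Nat.le_of_dvd (Nat.gcd_pos_of_pos_right _ hd0) hgdvd)

end BentMonomials

/-! ### Components of powers of the norm -/

section Extension

variable {K L : Type*} [Field K] [Fintype K] [Field L] [Fintype L] [Algebra K L]
  [Algebra (ZMod 2) K] [Algebra (ZMod 2) L] [IsScalarTower (ZMod 2) K L]

theorem hadamard_component_of_eq_algebraMap (F : L → L) (f : L → K)
    (hF : ∀ x, F x = algebraMap K L (f x)) (a l : L) :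
    hadamard (component F a) l =
      ∑ x, traceChar K ℤ (Algebra.trace K L a * f x + Algebra.trace K L (l * x)) := by
  rw [hadamard_component]
  refine sum_congr rfl fun x _ => ?_
  rw [traceChar_apply, ← Algebra.trace_trace (S := K), map_add, hF,
    mul_comm a, trace_algebraMap_mul, mul_comm (f x)]
  rfl

/-- The norm is a quadratic form with polarization `T(x * y ^ Q)`, which is nondegenerate. Expanding
the square along shifts `y` and summing over `x` first kills every term except `y = 0`. -/
theorem sum_traceChar_norm_sq (h : Module.finrank K L = 2) {b : K} (hb : b ≠ 0) (l : L) :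
    (∑ x : L, traceChar K ℤ (b * Algebra.norm K x + Algebra.trace K L (l * x))) ^ 2 =
      (Fintype.card K : ℤ) ^ 2 := by
  classical
  have hL : CharP L 2 := charP_two_of_algebra L
  have hK : CharP K 2 := charP_two_of_algebra K
  have hnorm (x y : L) : Algebra.norm K (x + y) = Algebra.norm K x + Algebra.norm K y +
      Algebra.trace K L (x * y ^ Fintype.card K) := by
    apply (algebraMap K L).injective
    have hfr (x y : L) : (x + y) ^ Fintype.card K = x ^ Fintype.card K + y ^ Fintype.card K := by
      rw [card_eq_two_pow_finrank, add_pow_char_pow]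
    have hyy : (y ^ Fintype.card K) ^ Fintype.card K = y := by
      rw [← pow_mul, ← sq, ← card_of_finrank_two h, FiniteField.pow_card]
    rw [map_add (algebraMap K L), map_add (algebraMap K L),
      algebraMap_norm_of_finrank_two h, algebraMap_norm_of_finrank_two h,
      algebraMap_norm_of_finrank_two h, algebraMap_trace_of_finrank_two h, pow_succ, pow_succ,
      pow_succ, hfr, mul_pow, hyy]
    ring
  set f : L → ℤ := fun x => traceChar K ℤ (b * Algebra.norm K x + Algebra.trace K L (l * x))
    with hf
  have hshift (x y : L) : f x * f (x + y) =
      f y * traceChar L ℤ (x * (y ^ Fintype.card K * algebraMap K L b)) := by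
    have h1 : traceChar L ℤ (x * (y ^ Fintype.card K * algebraMap K L b)) =
        traceChar K ℤ (b * Algebra.trace K L (x * y ^ Fintype.card K)) := by
      rw [← mul_assoc, mul_comm _ (algebraMap K L b), traceChar_apply,
        ← Algebra.trace_trace (S := K), trace_algebraMap_mul]
      rfl
    rw [h1, hf]
    simp only [← AddChar.map_add_eq_mul]
    congr 1
    rw [hnorm, mul_add l, map_add]
    linear_combination (b * Algebra.norm K x + Algebra.trace K L (l * x)) *
      CharTwo.two_eq_zero (R := K)
  have hz (y : L) : y ^ Fintype.card K * algebraMap K L b = 0 ↔ y = 0 := by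
    simp [hb, Fintype.card_ne_zero]
  calc (∑ x, f x) ^ 2 = ∑ x, ∑ y, f x * f (x + y) := by
        rw [sq, sum_mul]
        refine sum_congr rfl fun x _ => ?_
        rw [← mul_sum, ← Equiv.sum_comp (Equiv.addLeft x) f]
        rfl
    _ = ∑ y, f y * ∑ x, traceChar L ℤ (x * (y ^ Fintype.card K * algebraMap K L b)) := by
        rw [sum_comm]
        refine sum_congr rfl fun y _ => ?_
        rw [mul_sum]
        exact sum_congr rfl fun x _ => hshift x y
    _ = (Fintype.card K : ℤ) ^ 2 := by
        simp only [sum_traceChar_mul (R := ℤ) two_ne_zero, hz, mul_ite, mul_zero, sum_ite_eq',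
          mem_univ, if_true]
        simp [hf, AddChar.map_zero_eq_one, card_of_finrank_two h]

/-- If `T(a) = 0` the component is identically zero. Otherwise a `2 ^ i`-th root `b` of `T(a)` and
Frobenius invariance replace `N ^ (2 ^ i)` by `b * N`. -/
theorem isBent_component_iff_trace_ne_zero (h : Module.finrank K L = 2) {k : ℕ} (hk : 1 ≤ k)
    (hK : Fintype.card K = 2 ^ k) (i : ℕ) (F : L → L)
    (hF : ∀ x, F x = algebraMap K L (Algebra.norm K x ^ 2 ^ i)) (a : L) :
    IsBent k (component F a) ↔ Algebra.trace K L a ≠ 0 := by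
  have hchar : CharP K 2 := charP_two_of_algebra K
  have hW := hadamard_component_of_eq_algebraMap F _ hF a
  have h2 : (2 : ℤ) ≤ 2 ^ k := le_self_pow₀ (by norm_num) (by omega)
  constructor
  · intro hb ha
    have h0 := hW 0
    simp only [ha, zero_mul, map_zero, add_zero, AddChar.map_zero_eq_one, sum_const, card_univ,
      card_of_finrank_two h, hK] at h0
    have h0' : hadamard (component F a) 0 = (2 ^ k) ^ 2 := by rw [h0]; simp
    rcases hb 0 with h1 | h1 <;> rw [h0'] at h1 <;> nlinarith
  · intro ha l
    obtain ⟨b, hb⟩ : ∃ b : K, b ^ 2 ^ i = Algebra.trace K L a :=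
      (bijective_iterateFrobenius K 2 i).2 _
    have hb0 : b ≠ 0 := by
      rintro rfl
      exact ha (by rw [← hb, zero_pow (by positivity)])
    have h1 := sum_traceChar_norm_sq h hb0 l
    have h3 : hadamard (component F a) l =
        ∑ x : L, traceChar K ℤ (b * Algebra.norm K x + Algebra.trace K L (l * x)) := by
      rw [hW]
      refine sum_congr rfl fun x _ => ?_
      rw [← hb, ← mul_pow, traceChar_apply, traceChar_apply, map_add, trace_pow_two_pow, map_add]
    rw [← h3, hK] at h1
    push_cast at h1
    exact sq_eq_sq_iff_eq_or_eq_neg.mp h1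

theorem numBentComponents_norm_pow (h : Module.finrank K L = 2) {k : ℕ} (hk : 1 ≤ k)
    (hK : Fintype.card K = 2 ^ k) (i : ℕ) (F : L → L)
    (hF : ∀ x, F x = algebraMap K L (Algebra.norm K x ^ 2 ^ i)) :
    numBentComponents k F = 2 ^ (2 * k) - 2 ^ k := by
  classical
  have h1 : {a : L | IsBent k (component F a)}ᶜ =
      ↑({x : L | Algebra.trace K L x = 0} : Finset L) := by
    ext a
    simp [isBent_component_iff_trace_ne_zero h hk hK i F hF]
  have h2 := Set.ncard_add_ncard_compl {a : L | IsBent k (component F a)}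
  rw [h1, Set.ncard_coe_finset, card_trace_eq h, Nat.card_eq_fintype_card, card_of_finrank_two h,
    hK, ← pow_mul, mul_comm k] at h2
  rw [numBentComponents]
  omega

theorem cyclotomicEquiv_of_numBentComponents (h : Module.finrank K L = 2) {k : ℕ} (hk : 1 ≤ k)
    (hK : Fintype.card K = 2 ^ k) {d : ℕ} (hd0 : 0 < d) (hd : d < 2 ^ (2 * k) - 1)
    (hnum : numBentComponents k (fun x : L => x ^ d) = 2 ^ (2 * k) - 2 ^ k) :
    CyclotomicEquiv (2 * k) d (2 ^ k + 1) := by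
  have hL : Fintype.card L = 2 ^ (2 * k) := by
    rw [card_of_finrank_two h, hK, ← pow_mul, mul_comm]
  have hg := gcd_eq_of_numBentComponents k hk hL d hd0 hnum
  have hq : 2 ^ (2 * k) - 1 = (2 ^ k + 1) * (2 ^ k - 1) := by
    rw [← Nat.sq_sub_sq, one_pow, ← pow_mul, mul_comm]
  obtain ⟨e, rfl⟩ : 2 ^ k + 1 ∣ d := hg ▸ Nat.gcd_dvd_right _ _
  rw [hq, Nat.gcd_mul_left] at hg
  have he : e.Coprime (2 ^ k - 1) := by
    rw [Nat.coprime_comm]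
    exact Nat.eq_of_mul_eq_mul_left (by positivity) (hg.trans (mul_one _).symm)
  -- From `0 < e < 2 ^ k - 1`; thus no exponent `d` survives when `k = 1`.
  have hK2 : 2 < Fintype.card K := by
    rw [hq] at hd
    have h1 := Nat.lt_of_mul_lt_mul_left hd
    have h2 : e ≠ 0 := by rintro rfl; simp at hd0
    omega
  have hF (x : L) : x ^ ((2 ^ k + 1) * e) = algebraMap K L (Algebra.norm K x ^ e) := by
    rw [map_pow, algebraMap_norm_of_finrank_two h, hK, pow_mul]
  obtain ⟨a, ha⟩ : ∃ a : L, IsBent k (component (fun x : L => x ^ ((2 ^ k + 1) * e)) a) := by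
    by_contra! hne
    have h2 : numBentComponents k (fun x : L => x ^ ((2 ^ k + 1) * e)) = 0 := by
      simp [numBentComponents, hne]
    rw [h2] at hnum
    have : 2 ^ k < 2 ^ (2 * k) := Nat.pow_lt_pow_right (by norm_num) (by omega)
    omega
  have hW := hadamard_component_of_eq_algebraMap _ _ hF a
  have ha0 : Algebra.trace K L a ≠ 0 := by
    intro h0
    have h1 : hadamard (component (fun x : L => x ^ ((2 ^ k + 1) * e)) a) 0 = (2 ^ k) ^ 2 := by
      rw [hW]
      simp [h0, AddChar.map_zero_eq_one, hL, pow_mul, mul_comm]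
    have h2 : (2 : ℤ) ≤ 2 ^ k := le_self_pow₀ (by norm_num) (by omega)
    rcases ha 0 with h3 | h3 <;> rw [h1] at h3 <;> nlinarith
  obtain ⟨i, hi⟩ := exists_modEq_two_pow_of_traceChar_sum (L := L) h hK2 ha0 (hK ▸ he)
    fun l => by
      rw [← hW, hK]
      exact_mod_cast ha l
  refine ⟨i, ?_⟩
  rw [hq, mul_comm (2 ^ i)]
  rw [hK] at hi
  exact hi.mul_left' _

end Extension

/-! ### Exponents modulo the group order, and the main theorem -/

theorem pow_eq_pow_of_modEq_card_sub_one {L : Type*} [Field L] [Fintype L] {m n : ℕ}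
    (hm : m ≠ 0) (hn : n ≠ 0) (h : m ≡ n [MOD Fintype.card L - 1]) (x : L) : x ^ m = x ^ n := by
  classical
  rcases eq_or_ne x 0 with rfl | hx
  · rw [zero_pow hm, zero_pow hn]
  · have h1 : Units.mk0 x hx ^ m = Units.mk0 x hx ^ n :=
      pow_eq_pow_iff_modEq.mpr
        (h.of_dvd (by rw [← Fintype.card_units]; exact orderOf_dvd_card))
    simpa using congr_arg Units.val h1

theorem mainTheorem1 (k : ℕ) (hk : 1 ≤ k)
    (L : Type*) [Field L] [Fintype L] [Algebra (ZMod 2) L]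
    (hL : Fintype.card L = 2 ^ (2 * k))
    (d : ℕ) (hd0 : 0 < d) (hd : d < 2 ^ (2 * k) - 1) :
    numBentComponents k (fun x : L => x ^ d) = 2 ^ (2 * k) - 2 ^ k ↔
      CyclotomicEquiv (2 * k) d (2 ^ k + 1) := by
  have hfinL : Module.finrank (ZMod 2) L = 2 * k :=
    Nat.pow_right_injective le_rfl (card_eq_two_pow_finrank.symm.trans hL)
  have hfinK : Module.finrank (ZMod 2) (GaloisField 2 k) = k :=
    GaloisField.finrank 2 (by omega)
  -- Since `k` divides `2 * k`, the field with `2 ^ k` elements embeds in `L`; this embedding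
  -- supplies the quadratic extension.
  obtain ⟨f⟩ := FiniteField.nonempty_algHom_of_finrank_dvd (F := ZMod 2)
    (K := GaloisField 2 k) (L := L) (by rw [hfinK, hfinL]; exact dvd_mul_left _ _)
  let _ : Algebra (GaloisField 2 k) L := f.toRingHom.toAlgebra
  have _ : IsScalarTower (ZMod 2) (GaloisField 2 k) L :=
    IsScalarTower.of_algebraMap_eq fun x => (f.commutes x).symm
  let _ : Fintype (GaloisField 2 k) := Fintype.ofFinite _
  have hK : Fintype.card (GaloisField 2 k) = 2 ^ k := by
    rw [← Nat.card_eq_fintype_card, GaloisField.card 2 k (by omega)]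
  have h : Module.finrank (GaloisField 2 k) L = 2 := by
    have h1 := Module.finrank_mul_finrank (ZMod 2) (GaloisField 2 k) L
    rw [hfinK, hfinL, mul_comm] at h1
    exact Nat.eq_of_mul_eq_mul_right (by omega) h1
  constructor
  · exact cyclotomicEquiv_of_numBentComponents h hk hK hd0 hd
  · rintro ⟨i, hi⟩
    refine numBentComponents_norm_pow h hk hK i _ fun x => ?_
    rw [map_pow, algebraMap_norm_of_finrank_two h, hK, ← pow_mul, mul_comm (2 ^ k + 1)]
    exact pow_eq_pow_of_modEq_card_sub_one hd0.ne' (by positivity) (hL ▸ hi) x
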